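/- **Theorem.** For $p=(a,b,c,d,f,\alpha,\beta,\gamma)\in\mathbf C^8$ consider the third order operator of degree (at most) two $$L_p=\theta^3+x(a\theta^3+b\theta^2+c\theta+d)+f x^2(\theta+\alpha)(\theta+\beta)(\theta+\gamma),\qquad \theta=x\tfrac{d}{dx}.$$ Dividing by the leading coefficient $x^3(1+ax+fx^2)$, write it as $y'''+a_2y''+a_1y'+a_0y$ with $a_i\in\mathbf C(x)$, and let $Y\subset\mathbf C^8$ be the set of all $p$ for which the Calabi–Yau condition $$\mathcal W:=\tfrac13a_2''+\tfrac23a_2a_2'+\tfrac4{27}a_2^3+2a_0-\tfrac23a_1a_2-a_1'=0$$ holds identically in $x$. The symmetric group $S_3$ acts on $\mathbf C^8$ by permuting the exponents $\alpha,\beta,\gamma$, which does not change $L_p$; put $\sigma=2\,\frac{\alpha+\beta+\gamma}{3}$. Then $Y$ is an algebraic set, the union of its irreducible components, and $S_3$ permutes these components. Up to this action (that is, up to relabelling the exponents) there are exactly ten irreducible components: the components form exactly ten $S_3$-orbits. Exactly seven of the ten are not contained in $\{f=0\}$. Representatives of these seven can be chosen as follows. 1. The transverse component, on which $\sigma$ is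 not constant (not even on its part with $f\ne0$). It has dimension $3$ and is the family $$\theta^3+\tfrac a4x\bigl(4\theta^3+3(\alpha+\beta)\theta^2+(\alpha+\beta+2\alpha\beta)\theta+\alpha\beta\bigr)+\bigl(\tfrac a2\bigr)^2x^2(\theta+\alpha)\bigl(\theta+\tfrac{\alpha+\beta}2\bigr)(\theta+\beta),\quad a,\alpha,\beta\in\mathbf C.$$ 2. The main component, of dimension $4$, on which $\sigma=2$; it is the family $$\theta^3+x(2\theta+1)\bigl((c-2d)\theta^2+(c-2d)\theta+d\bigr)+fx^2(\theta+\alpha)(\theta+1)(\theta+2-\alpha),\quad c,d,f,\alpha\in\mathbf C.$$ 3. Five further components, on each of which $\sigma$ is constant, with $(\sigma,\dim)=(1,3),\ (3,3),\ (0,2),\ (2,2),\ (4,2)$. -/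

import Mathlib

open MvPolynomial

noncomputable section

namespace CYThird

/-! ### Algebraic sets in affine space over `ℂ` -/

/-- The Zariski topology on `ℂ^ι`: the closed sets are the common zero sets of polynomials. -/
abbrev zariski (ι : Type) : TopologicalSpace (ι → ℂ) :=
  TopologicalSpace.ofClosed {V | ∃ I : Ideal (MvPolynomial ι ℂ), V = zeroLocus ℂ I}
    ⟨⊤, by simp⟩
    (by
      intro A hA
      have hA' : ∀ V ∈ A, ∃ I : Ideal (MvPolynomial ι ℂ), V = zeroLocus ℂ I := fun V hV => hA hV
      choose! J hJ using hA'
      refine ⟨⨆ V ∈ A, J V, ?_⟩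
      have hgc := zeroLocus_vanishingIdeal_galoisConnection (k := ℂ) (K := ℂ) (σ := ι)
      apply Set.Subset.antisymm
      · intro x hx
        have h : (⨆ V ∈ A, J V) ≤ vanishingIdeal ℂ {x} := by
          refine iSup₂_le fun V hV p hp => ?_
          rintro y rfl
          have hy : y ∈ zeroLocus ℂ (J V) := hJ V hV ▸ hx V hV
          exact hy p hp
        intro p hp
        exact h hp x rfl
      · intro x hx V hV
        rw [hJ V hV]
        intro p hp
        exact hx p ((le_iSup₂ (f := fun V (_ : V ∈ A) => J V) V hV) hp))
    (by
      rintro _ ⟨I, rfl⟩ _ ⟨J, rfl⟩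
      refine ⟨I ⊓ J, ?_⟩
      apply Set.Subset.antisymm
      · rintro x (hx | hx) p hp
        · exact hx p hp.1
        · exact hx p hp.2
      · intro x hx
        by_contra hcon
        rw [Set.mem_union, not_or] at hcon
        obtain ⟨h1, h2⟩ := hcon
        simp only [mem_zeroLocus_iff, not_forall] at h1 h2
        obtain ⟨p, hp, hp0⟩ := h1
        obtain ⟨q, hq, hq0⟩ := h2
        have h := hx (p * q) ⟨I.mul_mem_right q hp, J.mul_mem_left p hq⟩
        rw [map_mul] at h
        exact (mul_ne_zero hp0 hq0) h)

/-- The irreducible components of a subset `Y` of `ℂ^ι`: the maximal subsets of `Y` that are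
irreducible in the Zariski topology. -/
def irredComponents {ι : Type} (Y : Set (ι → ℂ)) : Set (Set (ι → ℂ)) :=
  {Z | Maximal (fun S => @IsIrreducible (ι → ℂ) (zariski ι) S ∧ S ⊆ Y) Z}

/-- The dimension of an algebraic set: the Krull dimension of its coordinate ring. -/
def algDim {ι : Type} (Z : Set (ι → ℂ)) : WithBot ℕ∞ :=
  ringKrullDim (MvPolynomial ι ℂ ⧸ vanishingIdeal ℂ Z)

/-! ### The operators

A point `p = (a, b, c, d, f, α, β, γ)` of `ℂ^8` stands for the operator
`θ³ + x(aθ³ + bθ² + cθ + d) + f x²(θ+α)(θ+β)(θ+γ)`, where `θ = x d/dx`. -/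

/-- `θ + s`, acting on functions. -/
def thetaAdd (s : ℂ) (y : ℂ → ℂ) : ℂ → ℂ := fun x => x * deriv y x + s * y x

/-- The operator attached to `p`, acting on functions. -/
def thetaOp (p : Fin 8 → ℂ) (y : ℂ → ℂ) : ℂ → ℂ := fun x =>
  thetaAdd 0 (thetaAdd 0 (thetaAdd 0 y)) x
    + x * (p 0 * thetaAdd 0 (thetaAdd 0 (thetaAdd 0 y)) x + p 1 * thetaAdd 0 (thetaAdd 0 y) x
      + p 2 * thetaAdd 0 y x + p 3 * y x)
    + p 4 * x ^ 2 * thetaAdd (p 5) (thetaAdd (p 6) (thetaAdd (p 7) y)) x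

/-- The coefficient of `θ³` after expansion. -/
def thetaCoeff3 (p : Fin 8 → ℂ) (x : ℂ) : ℂ := 1 + p 0 * x + p 4 * x ^ 2

/-- The coefficient of `θ²` after expansion. -/
def thetaCoeff2 (p : Fin 8 → ℂ) (x : ℂ) : ℂ := p 1 * x + p 4 * (p 5 + p 6 + p 7) * x ^ 2

/-- The coefficient of `θ` after expansion. -/
def thetaCoeff1 (p : Fin 8 → ℂ) (x : ℂ) : ℂ :=
  p 2 * x + p 4 * (p 5 * p 6 + p 5 * p 7 + p 6 * p 7) * x ^ 2

/-- The coefficient of `1` after expansion. -/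
def thetaCoeff0 (p : Fin 8 → ℂ) (x : ℂ) : ℂ := p 3 * x + p 4 * (p 5 * p 6 * p 7) * x ^ 2

/-- The coefficient `a₂` of the monic form `y''' + a₂ y'' + a₁ y' + a₀ y`. -/
def monicCoeff2 (p : Fin 8 → ℂ) (x : ℂ) : ℂ :=
  (3 * thetaCoeff3 p x + thetaCoeff2 p x) / (x * thetaCoeff3 p x)

/-- The coefficient `a₁` of the monic form `y''' + a₂ y'' + a₁ y' + a₀ y`. -/
def monicCoeff1 (p : Fin 8 → ℂ) (x : ℂ) : ℂ :=
  (thetaCoeff3 p x + thetaCoeff2 p x + thetaCoeff1 p x) / (x ^ 2 * thetaCoeff3 p x)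

/-- The coefficient `a₀` of the monic form `y''' + a₂ y'' + a₁ y' + a₀ y`. -/
def monicCoeff0 (p : Fin 8 → ℂ) (x : ℂ) : ℂ :=
  thetaCoeff0 p x / (x ^ 3 * thetaCoeff3 p x)

/-- The monic form is the operator divided by its leading coefficient. -/
theorem thetaOp_eq_monic (p : Fin 8 → ℂ) (y : ℂ → ℂ) (hy : Differentiable ℂ y) (x : ℂ)
    (hx : x ≠ 0) (h3 : thetaCoeff3 p x ≠ 0) :
    thetaOp p y x = x ^ 3 * thetaCoeff3 p x *
      (deriv (deriv (deriv y)) x + monicCoeff2 p x * deriv (deriv y) x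
        + monicCoeff1 p x * deriv y x + monicCoeff0 p x * y x) := by
  have hd : ∀ g : ℂ → ℂ, Differentiable ℂ g → Differentiable ℂ (deriv g) := fun g hg =>
    (hg.contDiff (n := 2)).differentiable_deriv_two
  have h1 := hd y hy
  have h2 := hd _ h1
  have key : ∀ (s : ℂ) (g : ℂ → ℂ), Differentiable ℂ g →
      deriv (thetaAdd s g) = fun z => deriv g z + z * deriv (deriv g) z + s * deriv g z := by
    intro s g hg
    funext z
    have e := (((hasDerivAt_id z).mul (hd g hg z).hasDerivAt).add
      ((hg z).hasDerivAt.const_mul s)).deriv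
    have e' : deriv (thetaAdd s g) z = _ := e
    rw [e']
    simp only [id]
    ring
  have key2 : ∀ (s t : ℂ), deriv (thetaAdd s (thetaAdd t y)) = fun z =>
      (1 + s) * (deriv y z + z * deriv (deriv y) z + t * deriv y z)
        + z * (2 * deriv (deriv y) z + z * deriv (deriv (deriv y)) z + t * deriv (deriv y) z) := by
    intro s t
    have hT : Differentiable ℂ (thetaAdd t y) := by
      unfold thetaAdd
      fun_prop
    rw [key s _ hT, key t y hy]
    funext z
    have e : deriv (fun z => deriv y z + z * deriv (deriv y) z + t * deriv y z) z =
        2 * deriv (deriv y) z + z * deriv (deriv (deriv y)) z + t * deriv (deriv y) z := by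
      have e := (((h1 z).hasDerivAt.add ((hasDerivAt_id z).mul (h2 z).hasDerivAt)).add
        ((h1 z).hasDerivAt.const_mul t)).deriv
      have e' : deriv (fun z => deriv y z + z * deriv (deriv y) z + t * deriv y z) z = _ := e
      rw [e']
      simp only [id]
      ring
    rw [e]
    ring
  have t3 : ∀ r s t : ℂ, thetaAdd r (thetaAdd s (thetaAdd t y)) x =
      x * deriv (thetaAdd s (thetaAdd t y)) x + r * thetaAdd s (thetaAdd t y) x := fun _ _ _ => rfl
  have t2 : ∀ s t : ℂ, thetaAdd s (thetaAdd t y) x =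
      x * deriv (thetaAdd t y) x + s * thetaAdd t y x := fun _ _ => rfl
  have t1 : ∀ t : ℂ, thetaAdd t y x = x * deriv y x + t * y x := fun _ => rfl
  unfold thetaOp monicCoeff2 monicCoeff1 monicCoeff0
  simp only [t3, key2, t2, key _ y hy, t1]
  field_simp
  unfold thetaCoeff3 thetaCoeff2 thetaCoeff1 thetaCoeff0
  ring

/-- The differential polynomial whose vanishing is the Calabi–Yau condition for
`y''' + a₂ y'' + a₁ y' + a₀ y`. -/
def calabiYauW (a₂ a₁ a₀ : ℂ → ℂ) (x : ℂ) : ℂ :=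
  1 / 3 * deriv (deriv a₂) x + 2 / 3 * a₂ x * deriv a₂ x + 4 / 27 * a₂ x ^ 3 + 2 * a₀ x
    - 2 / 3 * a₁ x * a₂ x - deriv a₁ x

/-- The set of parameters for which the rational function `W` vanishes identically, i.e. at
all points that are not among the zeros of its denominator. -/
def Y : Set (Fin 8 → ℂ) :=
  {p | ∀ x : ℂ, x ≠ 0 → thetaCoeff3 p x ≠ 0 →
    calabiYauW (monicCoeff2 p) (monicCoeff1 p) (monicCoeff0 p) x = 0}

/-- The exponents `α, β, γ`. -/
def exponents (p : Fin 8 → ℂ) : Fin 3 → ℂ := ![p 5, p 6, p 7]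

/-- The doubled average exponent. -/
def sigma (p : Fin 8 → ℂ) : ℂ := 2 * ((p 5 + p 6 + p 7) / 3)

/-- Relabelling of the exponents `α, β, γ`; it does not change the operator. -/
def permExponents (π : Equiv.Perm (Fin 3)) (p : Fin 8 → ℂ) : Fin 8 → ℂ :=
  ![p 0, p 1, p 2, p 3, p 4, exponents p (π 0), exponents p (π 1), exponents p (π 2)]

/-- The family
`θ³ + x(2θ+1)((c-2d)θ² + (c-2d)θ + d) + f x²(θ+α)(θ+1)(θ+2-α)`, expanded. -/
def mainFamily : Set (Fin 8 → ℂ) :=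
  {p | ∃ c d f α : ℂ, p = ![2 * (c - 2 * d), 3 * (c - 2 * d), c, d, f, α, 1, 2 - α]}

/-- The family `θ³ + (a/4) x(4θ³ + 3(α+β)θ² + (α+β+2αβ)θ + αβ)
+ (a/2)² x²(θ+α)(θ+(α+β)/2)(θ+β)`, expanded. -/
def transverseFamily : Set (Fin 8 → ℂ) :=
  {p | ∃ a α β : ℂ, p = ![a, a / 4 * (3 * (α + β)), a / 4 * (α + β + 2 * α * β),
    a / 4 * (α * β), (a / 2) ^ 2, α, (α + β) / 2, β]}

end CYThird

end

/-!
In the coordinate `log x`, where the derivation is `θ`, the condition `𝒲 = 0` keeps its shape, and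
clearing the denominator `A = 1 + ax + fx²` turns it into the vanishing of a polynomial in `x`,
that is, into six polynomial equations in `p`. At a simple root of `A` its value factors, which
forces the residue of the coefficient of `θ²` there to be `0`, `3 / 2` or `3`; at infinity its
leading coefficient factors too and, for `f ≠ 0`, makes one exponent the mean of the other two. The
remaining case distinction leaves ten families up to relabelling. Each of them is the image of an
affine space under a polynomial map with a polynomial left inverse, hence it is closed,
irreducible, and has the number of parameters as its dimension. Conditions that are invariant under
relabelling show that none of the ten lies in a relabelling of another.
-/

open scoped Topology

noncomputable section

namespace CYThird

/-! ### Polynomial maps between affine spaces -/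

theorem aeval_aeval {ι κ R : Type*} [CommRing R] {φ : κ → MvPolynomial ι R} {F : (ι → R) → κ → R}
    (hφ : ∀ k x, aeval x (φ k) = F x k) (x : ι → R) (p : MvPolynomial κ R) :
    aeval x (aeval φ p) = aeval (F x) p := by
  rw [comp_aeval_apply, funext fun k => hφ k x]

/-- A function on `R^ι` that is given by a polynomial. Being a `fun_prop` property, it is proved
automatically for functions that are written as polynomial expressions in the coordinates. -/
@[fun_prop]
def IsPolyFun {ι R : Type*} [CommRing R] (f : (ι → R) → R) : Prop :=
  ∃ p : MvPolynomial ι R, ∀ x, aeval x p = f x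

namespace IsPolyFun

section CommRing

variable {ι κ R : Type*} [CommRing R] {f g : (ι → R) → R}

@[fun_prop]
theorem const (c : R) : IsPolyFun fun _ : ι → R => c :=
  ⟨C c, fun x => aeval_C x c⟩

@[fun_prop]
theorem apply (i : ι) : IsPolyFun fun x : ι → R => x i :=
  ⟨X i, fun x => aeval_X x i⟩

@[fun_prop]
theorem add (hf : IsPolyFun f) (hg : IsPolyFun g) : IsPolyFun fun x => f x + g x := by
  obtain ⟨p, hp⟩ := hf
  obtain ⟨q, hq⟩ := hg
  exact ⟨p + q, fun x => by rw [map_add, hp, hq]⟩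

@[fun_prop]
theorem sub (hf : IsPolyFun f) (hg : IsPolyFun g) : IsPolyFun fun x => f x - g x := by
  obtain ⟨p, hp⟩ := hf
  obtain ⟨q, hq⟩ := hg
  exact ⟨p - q, fun x => by rw [map_sub, hp, hq]⟩

@[fun_prop]
theorem mul (hf : IsPolyFun f) (hg : IsPolyFun g) : IsPolyFun fun x => f x * g x := by
  obtain ⟨p, hp⟩ := hf
  obtain ⟨q, hq⟩ := hg
  exact ⟨p * q, fun x => by rw [map_mul, hp, hq]⟩

@[fun_prop]
theorem pow (hf : IsPolyFun f) (n : ℕ) : IsPolyFun fun x => f x ^ n := by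
  obtain ⟨p, hp⟩ := hf
  exact ⟨p ^ n, fun x => by rw [map_pow, hp]⟩

@[fun_prop]
theorem vecCons {n : ℕ} {F : (ι → R) → Fin n → R} (hf : IsPolyFun f)
    (hF : ∀ k, IsPolyFun fun x => F x k) (k : Fin (n + 1)) :
    IsPolyFun fun x => Matrix.vecCons (f x) (F x) k := by
  refine Fin.cases ?_ (fun k => ?_) k
  · simpa only [Matrix.cons_val_zero] using hf
  · simpa only [Matrix.cons_val_succ] using hF k

theorem aeval_comp {F : (ι → R) → κ → R} (hF : ∀ k, IsPolyFun fun x => F x k)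
    (p : MvPolynomial κ R) : IsPolyFun fun x => aeval (F x) p := by
  choose φ hφ using hF
  exact ⟨aeval φ p, fun x => aeval_aeval hφ x p⟩

end CommRing

@[fun_prop]
theorem div_const {ι K : Type*} [Field K] {f : (ι → K) → K} (hf : IsPolyFun f) (c : K) :
    IsPolyFun fun x => f x / c := by
  simpa only [div_eq_mul_inv] using hf.mul (const c⁻¹)

end IsPolyFun

section Zariski

variable {ι κ : Type}

theorem isClosed_zariski_iff {V : Set (ι → ℂ)} :
    IsClosed[zariski ι] V ↔ ∃ I : Ideal (MvPolynomial ι ℂ), V = zeroLocus ℂ I := by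
  rw [← @isOpen_compl_iff _ _ (zariski ι)]
  change Vᶜᶜ ∈ _ ↔ _
  rw [compl_compl]
  rfl

theorem isClosed_zariski_setOf_eq_zero {α : Sort*} {f : α → (ι → ℂ) → ℂ}
    (hf : ∀ a, IsPolyFun (f a)) : IsClosed[zariski ι] {x | ∀ a, f a x = 0} := by
  choose p hp using hf
  refine isClosed_zariski_iff.2 ⟨Ideal.span (Set.range p), ?_⟩
  ext x
  simp only [zeroLocus_span, Set.forall_mem_range, Set.mem_ofPred_eq, hp]

theorem continuous_zariski {F : (κ → ℂ) → ι → ℂ} (hF : ∀ k, IsPolyFun fun t => F t k) :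
    @Continuous _ _ (zariski κ) (zariski ι) F := by
  let _ := zariski ι
  let _ := zariski κ
  refine continuous_iff_isClosed.2 fun V hV => ?_
  obtain ⟨I, rfl⟩ := isClosed_zariski_iff.1 hV
  have hpre : F ⁻¹' zeroLocus ℂ I = {t | ∀ p : I, aeval (F t) (p : MvPolynomial ι ℂ) = 0} := by
    ext t
    simp only [Set.mem_preimage, mem_zeroLocus_iff, Set.mem_ofPred_eq, Subtype.forall]
  rw [hpre]
  exact isClosed_zariski_setOf_eq_zero fun p => IsPolyFun.aeval_comp hF p

theorem exists_aeval_ne_zero_of_isOpen {U : Set (ι → ℂ)} (hU : IsOpen[zariski ι] U)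
    (hne : U.Nonempty) : ∃ p : MvPolynomial ι ℂ, p ≠ 0 ∧ ∀ y, aeval y p ≠ 0 → y ∈ U := by
  obtain ⟨x, hx⟩ := hne
  obtain ⟨I, hI⟩ := isClosed_zariski_iff.1 (@IsOpen.isClosed_compl _ (zariski ι) _ hU)
  have hxI : x ∉ zeroLocus ℂ I := hI ▸ fun h => h hx
  simp only [mem_zeroLocus_iff, not_forall] at hxI
  obtain ⟨p, hpI, hpx⟩ := hxI
  refine ⟨p, fun h => hpx (h ▸ map_zero _), fun y hy => ?_⟩
  by_contra hyU
  exact hy ((hI ▸ hyU : y ∈ zeroLocus ℂ I) p hpI)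

theorem isIrreducible_zariski_univ : @IsIrreducible (ι → ℂ) (zariski ι) Set.univ := by
  refine ⟨⟨0, trivial⟩, fun U V hU hV ⟨x, _, hx⟩ ⟨y, _, hy⟩ => ?_⟩
  obtain ⟨p, hp, hpU⟩ := exists_aeval_ne_zero_of_isOpen hU ⟨x, hx⟩
  obtain ⟨q, hq, hqV⟩ := exists_aeval_ne_zero_of_isOpen hV ⟨y, hy⟩
  obtain ⟨z, hz⟩ : ∃ z : ι → ℂ, eval z (p * q) ≠ 0 := by
    by_contra! hzero
    exact mul_ne_zero hp hq (MvPolynomial.funext fun z => by rw [hzero, map_zero])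
  rw [map_mul] at hz
  exact ⟨z, trivial, hpU z (left_ne_zero_of_mul hz), hqV z (right_ne_zero_of_mul hz)⟩

/-- A polynomially embedded affine space `ℂ^κ` in `ℂ^ι`: the image of a polynomial map that has a
polynomial left inverse. -/
def IsEmbeddedAffineSpace (κ : Type) (Z : Set (ι → ℂ)) : Prop :=
  ∃ (F : (κ → ℂ) → ι → ℂ) (G : (ι → ℂ) → κ → ℂ), (∀ k, IsPolyFun fun t => F t k) ∧
    (∀ k, IsPolyFun fun x => G x k) ∧ Function.LeftInverse G F ∧ Z = Set.range F

namespace IsEmbeddedAffineSpace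

variable {Z : Set (ι → ℂ)}

theorem isIrreducible (h : IsEmbeddedAffineSpace κ Z) : @IsIrreducible _ (zariski ι) Z := by
  obtain ⟨F, -, hF, -, -, rfl⟩ := h
  let _ := zariski ι
  let _ := zariski κ
  rw [← Set.image_univ]
  exact isIrreducible_zariski_univ.image F (continuous_zariski hF).continuousOn

theorem isClosed (h : IsEmbeddedAffineSpace κ Z) : IsClosed[zariski ι] Z := by
  obtain ⟨F, G, hF, hG, hGF, rfl⟩ := h
  have hrange : Set.range F = {x | ∀ k, F (G x) k - x k = 0} := by
    ext x
    simp only [Set.mem_ofPred_eq, sub_eq_zero, ← funext_iff]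
    exact ⟨by rintro ⟨t, rfl⟩; rw [hGF], fun hx => ⟨G x, hx⟩⟩
  rw [hrange]
  choose φ hφ using hF
  refine isClosed_zariski_setOf_eq_zero fun k => ?_
  simp only [← hφ]
  exact (IsPolyFun.aeval_comp hG (φ k)).sub (IsPolyFun.apply k)

/-- Restriction of polynomials along `F` is onto, since its right inverse is restriction along
`G`, and its kernel is the vanishing ideal of `Z`. -/
theorem algDim_eq [Finite κ] (h : IsEmbeddedAffineSpace κ Z) : algDim Z = Nat.card κ := by
  obtain ⟨F, G, hF, hG, hGF, rfl⟩ := h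
  choose φ hφ using hF
  choose ψ hψ using hG
  have hsurj : Function.Surjective (aeval φ : MvPolynomial ι ℂ →ₐ[ℂ] MvPolynomial κ ℂ) := by
    refine fun q => ⟨aeval ψ q, MvPolynomial.funext fun t => ?_⟩
    rw [← aeval_eq_eval, aeval_aeval (F := F) hφ, aeval_aeval (F := G) hψ, hGF]
  have hker : vanishingIdeal ℂ (Set.range F) =
      RingHom.ker (aeval φ : MvPolynomial ι ℂ →ₐ[ℂ] MvPolynomial κ ℂ) := by
    ext p
    rw [mem_vanishingIdeal_iff, RingHom.mem_ker, MvPolynomial.funext_iff, Set.forall_mem_range]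
    exact forall_congr' fun t => by rw [map_zero (eval t), ← aeval_aeval hφ, aeval_eq_eval]
  rw [algDim, hker,
    ringKrullDim_eq_of_ringEquiv (Ideal.quotientKerAlgEquivOfSurjective hsurj).toRingEquiv,
    MvPolynomial.ringKrullDim_of_isNoetherianRing, ringKrullDim_eq_zero_of_field, zero_add]

end IsEmbeddedAffineSpace

end Zariski

theorem setOf_maximal_isIrreducible_iUnion {X α : Type*} [TopologicalSpace X] [Finite α]
    {Z : α → Set X} (hirr : ∀ a, IsIrreducible (Z a)) (hclosed : ∀ a, IsClosed (Z a))
    (hmax : ∀ a b, Z a ⊆ Z b → Z b ⊆ Z a) :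
    {S | Maximal (fun S => IsIrreducible S ∧ S ⊆ ⋃ a, Z a) S} = Set.range Z := by
  have exists_subset (S : Set X) (hS : IsIrreducible S) (hSZ : S ⊆ ⋃ a, Z a) :
      ∃ a, S ⊆ Z a := by
    have := isIrreducible_iff_sUnion_isClosed.1 hS (Set.finite_range Z).toFinset
      (by simpa using hclosed) (by simpa using hSZ)
    simpa using this
  ext S
  constructor
  · rintro ⟨⟨hS, hSZ⟩, hSmax⟩
    obtain ⟨a, ha⟩ := exists_subset S hS hSZ
    exact ⟨a, (hSmax ⟨hirr a, Set.subset_iUnion Z a⟩ ha).antisymm ha⟩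
  · rintro ⟨a, rfl⟩
    refine ⟨⟨hirr a, Set.subset_iUnion Z a⟩, fun S ⟨hS, hSZ⟩ haS => ?_⟩
    obtain ⟨b, hb⟩ := exists_subset S hS hSZ
    exact hb.trans (hmax a b (haS.trans hb))

/-! ### The Calabi–Yau condition as polynomial equations -/

section Theta

variable {x : ℂ}

theorem thetaAdd_zero (y : ℂ → ℂ) : thetaAdd 0 y = fun x => x * deriv y x :=
  funext fun x => by rw [thetaAdd, zero_mul, add_zero]

theorem deriv_div_pow {g : ℂ → ℂ} (hg : DifferentiableAt ℂ g x) (hx : x ≠ 0) (n : ℕ) :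
    deriv (fun z => g z / z ^ n) x = (x * deriv g x - n * g x) / x ^ (n + 1) := by
  rw [(hg.hasDerivAt.fun_div (hasDerivAt_pow n x) (pow_ne_zero n hx)).deriv]
  cases n with
  | zero => field_simp; simp
  | succ n => push_cast; field_simp; ring

/-- In the coordinate `log x`, where the derivation is `θ`, the Calabi–Yau condition is given by the
same differential polynomial. -/
theorem calabiYauW_eq_theta {u v : ℂ → ℂ} (hu : AnalyticAt ℂ u x) (hv : DifferentiableAt ℂ v x)
    (w : ℂ → ℂ) (hx : x ≠ 0) :
    calabiYauW (fun z => (3 + u z) / z) (fun z => (1 + u z + v z) / z ^ 2)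
        (fun z => w z / z ^ 3) x =
      (1 / 3 * thetaAdd 0 (thetaAdd 0 u) x + 2 / 3 * u x * thetaAdd 0 u x + 4 / 27 * u x ^ 3
        + 2 * w x - 2 / 3 * v x * u x - thetaAdd 0 v x) / x ^ 3 := by
  have h3u := hu.differentiableAt.const_add 3
  have h1u := hu.differentiableAt.const_add 1
  have hθu : DifferentiableAt ℂ (fun z => z * deriv u z) x :=
    differentiableAt_id.mul hu.deriv.differentiableAt
  have deriv_a₂ : deriv (fun z => (3 + u z) / z ^ 1) =ᶠ[𝓝 x]
      fun z => (z * deriv u z - (3 + u z)) / z ^ 2 := by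
    filter_upwards [hu.eventually_analyticAt, isOpen_ne.mem_nhds hx] with z hz hz0
    rw [deriv_div_pow (hz.differentiableAt.const_add 3) hz0 1, deriv_const_add, Nat.cast_one,
      one_mul]
  have deriv_deriv_a₂ := deriv_a₂.deriv_eq
  rw [deriv_div_pow (hθu.fun_sub h3u) hx 2, deriv_fun_sub hθu h3u, deriv_const_add,
    Nat.cast_two] at deriv_deriv_a₂
  have deriv_a₁ := deriv_div_pow (h1u.fun_add hv) hx 2
  rw [deriv_fun_add h1u hv, deriv_const_add, Nat.cast_two] at deriv_a₁
  simp only [pow_one] at deriv_a₂ deriv_deriv_a₂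
  simp only [calabiYauW, thetaAdd_zero, deriv_deriv_a₂, deriv_a₁, deriv_a₂.self_of_nhds]
  field_simp
  ring

theorem calabiYauW_congr {a₂ a₂' a₁ a₁' a₀ a₀' : ℂ → ℂ} (h₂ : a₂ =ᶠ[𝓝 x] a₂') (h₁ : a₁ =ᶠ[𝓝 x] a₁')
    (h₀ : a₀ x = a₀' x) : calabiYauW a₂ a₁ a₀ x = calabiYauW a₂' a₁' a₀' x := by
  rw [calabiYauW, calabiYauW, h₂.deriv.deriv_eq, h₂.deriv_eq, h₂.self_of_nhds, h₁.deriv_eq,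
    h₁.self_of_nhds, h₀]

end Theta

section Numerator

open scoped Polynomial

/-- The derivation `θ = x d/dx` on polynomials. -/
def theta {R : Type*} [CommRing R] (P : R[X]) : R[X] := Polynomial.X * Polynomial.derivative P

/-- The numerator `Q θ(P) - P θ(Q)` of `θ(P / Q)`. -/
def thetaWronskian {R : Type*} [CommRing R] (Q P : R[X]) : R[X] := Q * theta P - P * theta Q

/-- The polynomial `27 A³ W` for the operator `A θ³ + P₂ θ² + P₁ θ + P₀`, where `W` is formed
with the derivation `θ` in place of `d/dx`. -/
def cyNumerator {R : Type*} [CommRing R] (A P₂ P₁ P₀ : R[X]) : R[X] :=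
  9 * (A * theta (thetaWronskian A P₂) - 2 * thetaWronskian A P₂ * theta A)
    + 18 * P₂ * thetaWronskian A P₂ + 4 * P₂ ^ 3 + 54 * A ^ 2 * P₀ - 18 * A * P₂ * P₁
    - 27 * A * thetaWronskian A P₁

/-- At a simple root `x` of `A` the factors say that the residue `P₂ / θ(A)` is `0`, `3` or
`3 / 2`. -/
theorem eval_cyNumerator_of_root {R : Type*} [CommRing R] {A : R[X]} {x : R} (hx : A.eval x = 0)
    (P₂ P₁ P₀ : R[X]) :
    (cyNumerator A P₂ P₁ P₀).eval x = 2 * P₂.eval x * (P₂.eval x - 3 * (theta A).eval x) *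
      (2 * P₂.eval x - 3 * (theta A).eval x) := by
  simp only [cyNumerator, thetaWronskian, Polynomial.eval_add, Polynomial.eval_sub,
    Polynomial.eval_mul, Polynomial.eval_pow, Polynomial.eval_ofNat, hx]
  ring

theorem thetaAdd_zero_eval_div {P Q : ℂ[X]} {x : ℂ} (hx : Q.eval x ≠ 0) :
    thetaAdd 0 (fun z => P.eval z / Q.eval z) x =
      (thetaWronskian Q P).eval x / (Q ^ 2).eval x := by
  rw [congrFun (thetaAdd_zero _) x, ((P.hasDerivAt x).fun_div (Q.hasDerivAt x) hx).deriv]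
  simp only [thetaWronskian, theta, Polynomial.eval_sub, Polynomial.eval_mul, Polynomial.eval_pow,
    Polynomial.eval_X]
  ring

theorem thetaAdd_zero_thetaAdd_zero_eval_div {P Q : ℂ[X]} {x : ℂ} (hx : Q.eval x ≠ 0) :
    thetaAdd 0 (thetaAdd 0 fun z => P.eval z / Q.eval z) x =
      (thetaWronskian (Q ^ 2) (thetaWronskian Q P)).eval x / (Q ^ 4).eval x := by
  have hθ : (thetaAdd 0 fun z => P.eval z / Q.eval z) =ᶠ[𝓝 x]
      fun z => (thetaWronskian Q P).eval z / (Q ^ 2).eval z := by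
    filter_upwards [Q.continuous.continuousAt.eventually_ne hx] with z hz
    exact thetaAdd_zero_eval_div hz
  rw [congrFun (thetaAdd_zero _) x, hθ.deriv_eq, ← congrFun (thetaAdd_zero _) x,
    thetaAdd_zero_eval_div (by rw [Polynomial.eval_pow]; exact pow_ne_zero 2 hx), ← pow_mul]

theorem calabiYauW_eq_cyNumerator (A P₂ P₁ P₀ : ℂ[X]) {x : ℂ} (hx : x ≠ 0) (hA : A.eval x ≠ 0) :
    calabiYauW (fun z => (3 + P₂.eval z / A.eval z) / z)
      (fun z => (1 + P₂.eval z / A.eval z + P₁.eval z / A.eval z) / z ^ 2)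
      (fun z => P₀.eval z / A.eval z / z ^ 3) x =
    (cyNumerator A P₂ P₁ P₀).eval x / (27 * (x * A.eval x) ^ 3) := by
  have hdiv (P : ℂ[X]) : AnalyticAt ℂ (fun z => P.eval z / A.eval z) x :=
    (AnalyticOnNhd.eval_polynomial P x trivial).div (AnalyticOnNhd.eval_polynomial A x trivial) hA
  rw [calabiYauW_eq_theta (hdiv P₂) (hdiv P₁).differentiableAt _ hx,
    thetaAdd_zero_thetaAdd_zero_eval_div hA, thetaAdd_zero_eval_div hA, thetaAdd_zero_eval_div hA]
  have theta_sq : theta (A ^ 2) = 2 * A * theta A := by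
    rw [theta, theta, sq, Polynomial.derivative_mul]
    ring
  simp only [cyNumerator, thetaWronskian, theta_sq, Polynomial.eval_add, Polynomial.eval_sub,
    Polynomial.eval_mul, Polynomial.eval_pow, Polynomial.eval_ofNat]
  field_simp
  ring

end Numerator

section Equations

open scoped Polynomial

/-- The polynomial `c₀ + c₁ x + c₂ x²`. -/
def quadratic (c₀ c₁ c₂ : ℂ) : ℂ[X] :=
  Polynomial.C c₀ + Polynomial.C c₁ * Polynomial.X + Polynomial.C c₂ * Polynomial.X ^ 2

theorem eval_quadratic (c₀ c₁ c₂ x : ℂ) :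
    (quadratic c₀ c₁ c₂).eval x = c₀ + c₁ * x + c₂ * x ^ 2 := by
  simp only [quadratic, Polynomial.eval_add, Polynomial.eval_mul, Polynomial.eval_pow,
    Polynomial.eval_C, Polynomial.eval_X]

theorem theta_quadratic (c₀ c₁ c₂ : ℂ) :
    theta (quadratic c₀ c₁ c₂) = quadratic 0 c₁ (2 * c₂) := by
  simp only [theta, quadratic, Polynomial.derivative_add, Polynomial.derivative_C,
    Polynomial.derivative_C_mul, Polynomial.derivative_X, Polynomial.derivative_X_sq, map_mul,
    map_zero, map_ofNat]
  ring

/-- The polynomial `27 x³ A³ W` for the operator attached to `p`, where `A` is its coefficient of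
`θ³`. -/
def cyPolynomial (p : Fin 8 → ℂ) : ℂ[X] :=
  cyNumerator (quadratic 1 (p 0) (p 4)) (quadratic 0 (p 1) (p 4 * (p 5 + p 6 + p 7)))
    (quadratic 0 (p 2) (p 4 * (p 5 * p 6 + p 5 * p 7 + p 6 * p 7)))
    (quadratic 0 (p 3) (p 4 * (p 5 * p 6 * p 7)))

/-- The coefficients of `x, …, x⁶` in `cyPolynomial`, where `s`, `q`, `r` are the elementary
symmetric functions of the exponents. -/
def cyCoeffs (a b c d f s q r : ℂ) : Fin 6 → ℂ :=
  ![9 * (b - 3 * c + 6 * d),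
    9 * (2 * b ^ 2 - a * b - 3 * a * c + 12 * a * d - 2 * b * c + f * (4 * s - 6 * q + 6 * r)),
    4 * b ^ 3 + 54 * a ^ 2 * d - 18 * a * b * c + f * (108 * d - 54 * b - 81 * a * q
      + 108 * a * r + 27 * a * s - 18 * b * q + 54 * b * s - 18 * c * s),
    f * (27 * a * c - 9 * a * b - 18 * b ^ 2 + 108 * a * d - 18 * b * c
      + (9 * a ^ 2 + 12 * b ^ 2 + 18 * a * b - 18 * a * c) * s - (27 * a ^ 2 + 18 * a * b) * q
      + 54 * a ^ 2 * r + f * (36 * s ^ 2 - 36 * s - 54 * q - 18 * q * s + 108 * r)),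
    3 * f ^ 2 * (3 * b + 9 * c + 18 * d - 9 * a * q + 36 * a * r - 3 * a * s + 6 * a * s ^ 2
      - 6 * b * q - 6 * b * s + 4 * b * s ^ 2 - 6 * c * s - 6 * a * q * s),
    2 * f ^ 3 * (27 * r + 2 * s ^ 3 - 9 * q * s)]

theorem cyPolynomial_eq (p : Fin 8 → ℂ) :
    cyPolynomial p = Polynomial.X * Polynomial.ofFn 6 (cyCoeffs (p 0) (p 1) (p 2) (p 3) (p 4)
      (p 5 + p 6 + p 7) (p 5 * p 6 + p 5 * p 7 + p 6 * p 7) (p 5 * p 6 * p 7)) := by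
  generalize hs : p 5 + p 6 + p 7 = s
  generalize hq : p 5 * p 6 + p 5 * p 7 + p 6 * p 7 = q
  generalize hr : p 5 * p 6 * p 7 = r
  rw [cyPolynomial, hs, hq, hr, Polynomial.ofFn_eq_sum_monomial, Fin.sum_univ_six]
  simp only [cyNumerator, thetaWronskian, theta, quadratic, cyCoeffs, Matrix.cons_val,
    Fin.coe_ofNat_eq_mod, Nat.reduceMod, ← Polynomial.C_mul_X_pow_eq_monomial,
    Polynomial.derivative_mul, Polynomial.derivative_C, Polynomial.derivative_X,
    Polynomial.derivative_X_sq, Polynomial.derivative_one, Polynomial.derivative_ofNat, map_add,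
    map_sub, map_mul, map_pow, map_ofNat, map_one, map_zero]
  ring

theorem thetaCoeff3_eq_eval (p : Fin 8 → ℂ) (x : ℂ) :
    thetaCoeff3 p x = (quadratic 1 (p 0) (p 4)).eval x := by
  rw [thetaCoeff3, eval_quadratic]

theorem calabiYauW_monicCoeff (p : Fin 8 → ℂ) {x : ℂ} (hx : x ≠ 0) (hA : thetaCoeff3 p x ≠ 0) :
    calabiYauW (monicCoeff2 p) (monicCoeff1 p) (monicCoeff0 p) x =
      (cyPolynomial p).eval x / (27 * (x * thetaCoeff3 p x) ^ 3) := by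
  have hne : ∀ᶠ z in 𝓝 x, z ≠ 0 ∧ thetaCoeff3 p z ≠ 0 := by
    have hcont : Continuous (thetaCoeff3 p) := by unfold thetaCoeff3; fun_prop
    exact (continuousAt_id.eventually_ne hx).and (hcont.continuousAt.eventually_ne hA)
  rw [cyPolynomial, thetaCoeff3_eq_eval, ← calabiYauW_eq_cyNumerator _ _ _ _ hx
    (thetaCoeff3_eq_eval p x ▸ hA)]
  apply calabiYauW_congr
  · filter_upwards [hne] with z ⟨hz, hAz⟩
    rw [← thetaCoeff3_eq_eval, monicCoeff2, thetaCoeff2, eval_quadratic]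
    field_simp
    ring
  · filter_upwards [hne] with z ⟨hz, hAz⟩
    rw [← thetaCoeff3_eq_eval, monicCoeff1, thetaCoeff2, thetaCoeff1, eval_quadratic,
      eval_quadratic]
    field_simp
    ring
  · rw [← thetaCoeff3_eq_eval, monicCoeff0, thetaCoeff0, eval_quadratic]
    field_simp
    ring

theorem mem_Y_iff {p : Fin 8 → ℂ} : p ∈ Y ↔ cyPolynomial p = 0 := by
  refine ⟨fun h => ?_, fun h x hx hA => by
    rw [calabiYauW_monicCoeff p hx hA, h, Polynomial.eval_zero, zero_div]⟩
  have hA : quadratic 1 (p 0) (p 4) ≠ 0 := by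
    intro h0
    simpa [eval_quadratic] using congrArg (Polynomial.eval 0) h0
  have heval (x : ℂ) : (cyPolynomial p * (Polynomial.X * quadratic 1 (p 0) (p 4))).eval x = 0 := by
    rw [Polynomial.eval_mul, Polynomial.eval_mul, Polynomial.eval_X, ← thetaCoeff3_eq_eval,
      mul_eq_zero, or_iff_not_imp_right]
    intro hx
    have hW := h x (left_ne_zero_of_mul hx) (right_ne_zero_of_mul hx)
    rw [calabiYauW_monicCoeff p (left_ne_zero_of_mul hx) (right_ne_zero_of_mul hx)] at hW
    exact (div_eq_zero_iff.1 hW).resolve_right (mul_ne_zero (by norm_num) (pow_ne_zero 3 hx))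
  exact (mul_eq_zero.1 (Polynomial.funext fun x => (heval x).trans
    Polynomial.eval_zero.symm)).resolve_right (mul_ne_zero Polynomial.X_ne_zero hA)

theorem mem_Y_iff_cyCoeffs {p : Fin 8 → ℂ} :
    p ∈ Y ↔ cyCoeffs (p 0) (p 1) (p 2) (p 3) (p 4) (p 5 + p 6 + p 7)
      (p 5 * p 6 + p 5 * p 7 + p 6 * p 7) (p 5 * p 6 * p 7) = 0 := by
  rw [mem_Y_iff, cyPolynomial_eq, mul_eq_zero, or_iff_right Polynomial.X_ne_zero,
    map_eq_zero_iff _ (Polynomial.injective_ofFn 6)]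

end Equations

/-! ### The components -/

/-- The operators `(1 + mx)(θ³ + x(2θ+1)(kθ² + kθ + kα(1-α)))`. -/
def leftHalfFamily : Set (Fin 8 → ℂ) :=
  {p | ∃ m k α : ℂ, p = ![m + 2 * k, 3 * k, k + 2 * (k * (α * (1 - α))), k * (α * (1 - α)),
    2 * m * k, α, 1 / 2, 1 - α]}

/-- The operators `(θ³ + x(2θ+1)(kθ² + kθ + k(α-1)(2-α)))(1 + mx)`. -/
def rightHalfFamily : Set (Fin 8 → ℂ) :=
  {p | ∃ m k α : ℂ, p = ![m + 2 * k, 3 * k + 3 * m, k + 2 * (k * ((α - 1) * (2 - α))) + 3 * m,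
    k * ((α - 1) * (2 - α)) + m, 2 * m * k, α, 3 / 2, 3 - α]}

/-- The operators `(1 + ax + fx²)θ³`. -/
def leftCubeFamily : Set (Fin 8 → ℂ) :=
  {p | ∃ a f : ℂ, p = ![a, 0, 0, 0, f, 0, 0, 0]}

/-- The operators `(1 + mx)θ³(1 + nx)`. -/
def midCubeFamily : Set (Fin 8 → ℂ) :=
  {p | ∃ m n : ℂ, p = ![m + n, 3 * n, 3 * n, n, m * n, 1, 1, 1]}

/-- The operators `θ³(1 + ax + fx²)`. -/
def rightCubeFamily : Set (Fin 8 → ℂ) :=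
  {p | ∃ a f : ℂ, p = ![a, 3 * a, 3 * a, a, f, 2, 2, 2]}

/-- The operators `θ³ + x(2θ+1)(kθ² + kθ + d)`, with arbitrary exponents. -/
def hypergeomFamily : Set (Fin 8 → ℂ) :=
  {p | ∃ k d α β γ : ℂ, p = ![2 * k, 3 * k, k + 2 * d, d, 0, α, β, γ]}

/-- The operators `(1 + ax)θ³`, with arbitrary exponents. -/
def leftCubeLinearFamily : Set (Fin 8 → ℂ) :=
  {p | ∃ a α β γ : ℂ, p = ![a, 0, 0, 0, 0, α, β, γ]}

/-- The operators `θ³(1 + ax)`, with arbitrary exponents. -/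
def rightCubeLinearFamily : Set (Fin 8 → ℂ) :=
  {p | ∃ a α β γ : ℂ, p = ![a, 3 * a, 3 * a, a, 0, α, β, γ]}

/-- Representatives of the irreducible components of `Y` up to relabelling. -/
def component : Fin 10 → Set (Fin 8 → ℂ) :=
  ![transverseFamily, mainFamily, leftHalfFamily, rightHalfFamily, leftCubeFamily, midCubeFamily,
    rightCubeFamily, hypergeomFamily, leftCubeLinearFamily, rightCubeLinearFamily]

section Solving

variable {a b c d f α β γ m n : ℂ}

theorem vec_mem_Y_iff :
    ![a, b, c, d, f, α, β, γ] ∈ Y ↔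
      cyCoeffs a b c d f (α + β + γ) (α * β + α * γ + β * γ) (α * β * γ) = 0 :=
  mem_Y_iff_cyCoeffs

theorem component_subset_Y (i : Fin 10) : component i ⊆ Y := by
  intro p hp
  rw [mem_Y_iff_cyCoeffs]
  fin_cases i
  on_goal 1 => obtain ⟨a, α, β, rfl⟩ := hp
  on_goal 2 => obtain ⟨c, d, f, α, rfl⟩ := hp
  on_goal 3 => obtain ⟨m, k, α, rfl⟩ := hp
  on_goal 4 => obtain ⟨m, k, α, rfl⟩ := hp
  on_goal 5 => obtain ⟨a, f, rfl⟩ := hp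
  on_goal 6 => obtain ⟨m, n, rfl⟩ := hp
  on_goal 7 => obtain ⟨a, f, rfl⟩ := hp
  on_goal 8 => obtain ⟨k, d, α, β, γ, rfl⟩ := hp
  on_goal 9 => obtain ⟨a, α, β, γ, rfl⟩ := hp
  on_goal 10 => obtain ⟨a, α, β, γ, rfl⟩ := hp
  all_goals
    simp only [cyCoeffs, Matrix.cons_eq_zero_iff, Matrix.zero_empty, and_true, Matrix.cons_val]
    refine ⟨?_, ?_, ?_, ?_, ?_, ?_⟩ <;> ring

theorem eq_of_mem_Y (h : ![a, b, c, d, f, α, β, γ] ∈ Y) : c = 2 * d + b / 3 := by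
  have h₁ : 9 * (b - 3 * c + 6 * d) = 0 := congrFun (vec_mem_Y_iff.1 h) 0
  linear_combination -h₁ / 27

theorem mem_of_f_eq_zero (h : ![a, b, c, d, 0, α, β, γ] ∈ Y) :
    ![a, b, c, d, 0, α, β, γ] ∈ hypergeomFamily ∪ leftCubeLinearFamily ∪ rightCubeLinearFamily := by
  obtain rfl := eq_of_mem_Y h
  have h₂ := congrFun (vec_mem_Y_iff.1 h) 1
  have h₃ := congrFun (vec_mem_Y_iff.1 h) 2
  simp only [cyCoeffs, Matrix.cons_val, Pi.zero_apply] at h₂ h₃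
  have h_bd : (2 * b - 3 * a) * (b - 3 * d) = 0 := by linear_combination h₂ / 6
  have h_ba : (2 * b - 3 * a) * (b * (b - 3 * a)) = 0 := by linear_combination (h₃ - a * h₂) / 2
  by_cases hab : 2 * b - 3 * a = 0
  · obtain rfl : b = 3 * (a / 2) := by linear_combination hab / 2
    exact .inl (.inl ⟨a / 2, d, α, β, γ, by ring_nf⟩)
  · obtain rfl : b = 3 * d := sub_eq_zero.1 ((mul_eq_zero.1 h_bd).resolve_left hab)
    rcases mul_eq_zero.1 ((mul_eq_zero.1 h_ba).resolve_left hab) with hb | hb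
    · obtain rfl : d = 0 := by linear_combination hb / 3
      exact .inl (.inr ⟨a, α, β, γ, by ring_nf⟩)
    · obtain rfl : d = a := by linear_combination hb / 3
      exact .inr ⟨d, α, β, γ, by ring_nf⟩

theorem exists_residue (hm : m ≠ 0) (h : ![-(m + n), b, c, d, m * n, α, β, γ] ∈ Y) :
    ∃ l ∈ ({0, 3 / 2, 3} : Set ℂ), b + n * (α + β + γ) = l * (n - m) := by
  have hroot : (quadratic 1 (-(m + n)) (m * n)).eval m⁻¹ = 0 := by
    rw [eval_quadratic]
    field_simp
    ring
  have hN := eval_cyNumerator_of_root hroot (quadratic 0 b (m * n * (α + β + γ)))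
    (quadratic 0 c (m * n * (α * β + α * γ + β * γ))) (quadratic 0 d (m * n * (α * β * γ)))
  have hp : (cyPolynomial ![-(m + n), b, c, d, m * n, α, β, γ]).eval m⁻¹ = 0 := by
    rw [mem_Y_iff.1 h, Polynomial.eval_zero]
  simp only [cyPolynomial, Matrix.cons_val] at hp
  rw [hp] at hN
  simp only [theta_quadratic, eval_quadratic] at hN
  field_simp at hN
  have hprod : (b + n * (α + β + γ)) * ((b + n * (α + β + γ) - 3 / 2 * (n - m)) *
      (b + n * (α + β + γ) - 3 * (n - m))) = 0 := by
    linear_combination -hN / 4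
  rw [mul_eq_zero, mul_eq_zero, sub_eq_zero, sub_eq_zero] at hprod
  rcases hprod with h0 | h32 | h3
  · exact ⟨0, by simp, by rw [h0, zero_mul]⟩
  · exact ⟨3 / 2, by simp, h32⟩
  · exact ⟨3, by simp, h3⟩

theorem middle_exponent_of_distinct_roots (hmn : m ≠ n)
    (hm : ∃ l ∈ ({0, 3 / 2, 3} : Set ℂ), b + n * (3 * β) = l * (n - m))
    (hn : ∃ l ∈ ({0, 3 / 2, 3} : Set ℂ), b + m * (3 * β) = l * (m - n)) :
    β = 0 ∧ b = 0 ∨ β = 2 ∧ b = 3 * -(m + n) ∨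
      β = 1 / 2 ∧ 9 * (m * n) = 2 * b * (3 * -(m + n) - 2 * b) ∨
      β = 3 / 2 ∧ 9 * (m * n) = 2 * (3 * -(m + n) - b) * (2 * b - 3 * -(m + n)) ∨
      β = 1 ∧ (2 * b = 3 * -(m + n) ∨ 9 * (m * n) = b * (3 * -(m + n) - b)) := by
  obtain ⟨l, hl, hm⟩ := hm
  obtain ⟨l', hl', hn⟩ := hn
  obtain rfl : β = (l + l') / 3 := by
    refine mul_left_cancel₀ (sub_ne_zero.2 hmn) ?_
    linear_combination (hn - hm) / 3
  obtain rfl : b = -(l * m + l' * n) := by linear_combination hm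
  simp only [Set.mem_insert_iff, Set.mem_singleton_iff] at hl hl'
  rcases hl with rfl | rfl | rfl <;> rcases hl' with rfl | rfl | rfl
  · exact .inl ⟨by ring, by ring⟩
  · exact .inr (.inr (.inl ⟨by ring, by ring⟩))
  · exact .inr (.inr (.inr (.inr ⟨by ring, .inr (by ring)⟩)))
  · exact .inr (.inr (.inl ⟨by ring, by ring⟩))
  · exact .inr (.inr (.inr (.inr ⟨by ring, .inl (by ring)⟩)))
  · exact .inr (.inr (.inr (.inl ⟨by ring, by ring⟩)))
  · exact .inr (.inr (.inr (.inr ⟨by ring, .inr (by ring)⟩)))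
  · exact .inr (.inr (.inr (.inl ⟨by ring, by ring⟩)))
  · exact .inr (.inl ⟨by ring, by ring⟩)

theorem coeff_two_of_middle (h : ![a, b, c, d, f, α, β, γ] ∈ Y) (hβ : α + γ = 2 * β) :
    (2 * b - 3 * a) * (b - 3 * d) + 9 * f * (β - 1) * (α * γ - 2 * β) = 0 := by
  obtain rfl := eq_of_mem_Y h
  have h₂ := congrFun (vec_mem_Y_iff.1 h) 1
  simp only [cyCoeffs, Matrix.cons_val, Pi.zero_apply] at h₂
  obtain rfl : γ = 2 * β - α := by linear_combination hβ
  linear_combination h₂ / 6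

theorem coeff_five_of_middle (h : ![a, b, c, d, f, α, β, γ] ∈ Y) (hf : f ≠ 0)
    (hβ : α + γ = 2 * β) :
    ((2 * β - 1) ^ 2 - α * γ) * (2 * b - 3 * a * (2 * β - 1))
      + 3 * (β - 1) * (a * (2 * β - 1) ^ 2 - 4 * d) = 0 := by
  obtain rfl := eq_of_mem_Y h
  have h₅ := congrFun (vec_mem_Y_iff.1 h) 4
  simp only [cyCoeffs, Matrix.cons_val, Pi.zero_apply] at h₅
  replace h₅ := (mul_eq_zero.1 h₅).resolve_left (mul_ne_zero three_ne_zero (pow_ne_zero 2 hf))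
  obtain rfl : γ = 2 * β - α := by linear_combination hβ
  linear_combination h₅ / 3

theorem middle_of_f_ne_zero (h : ![a, b, c, d, f, α, β, γ] ∈ Y) (hf : f ≠ 0) :
    α + γ = 2 * β ∨ α + β = 2 * γ ∨ β + γ = 2 * α := by
  have h₆ := congrFun (vec_mem_Y_iff.1 h) 5
  simp only [cyCoeffs, Matrix.cons_val, Pi.zero_apply] at h₆
  replace h₆ := (mul_eq_zero.1 h₆).resolve_left (mul_ne_zero two_ne_zero (pow_ne_zero 3 hf))
  have hprod : (α + γ - 2 * β) * ((α + β - 2 * γ) * (β + γ - 2 * α)) = 0 := by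
    linear_combination -h₆
  rwa [mul_eq_zero, mul_eq_zero, sub_eq_zero, sub_eq_zero, sub_eq_zero] at hprod

theorem mem_leftCubeFamily (h : ![a, 0, c, d, f, α, 0, γ] ∈ Y) (hf : f ≠ 0)
    (hαγ : α + γ = 0) (haf : a ^ 2 ≠ 4 * f) : ![a, 0, c, d, f, α, 0, γ] ∈ leftCubeFamily := by
  have h₂ := coeff_two_of_middle h (by rw [hαγ, mul_zero])
  have h₅ := coeff_five_of_middle h hf (by rw [hαγ, mul_zero])
  have hd : 4 * d = a * (α * γ) := by linear_combination h₅ / 3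
  obtain rfl : γ = -α := by linear_combination hαγ
  have hα : (a ^ 2 - 4 * f) * α ^ 2 = 0 := by linear_combination (-4 * h₂ + 9 * a * hd) / 9
  obtain rfl : α = 0 := pow_eq_zero_iff two_ne_zero |>.1 <|
    (mul_eq_zero.1 hα).resolve_left (sub_ne_zero.2 haf)
  obtain rfl : d = 0 := by linear_combination hd / 4
  obtain rfl := eq_of_mem_Y h
  exact ⟨a, f, by ring_nf⟩

theorem mem_rightCubeFamily (h : ![a, 3 * a, c, d, f, α, 2, γ] ∈ Y) (hf : f ≠ 0)
    (hαγ : α + γ = 4) (haf : a ^ 2 ≠ 4 * f) :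
    ![a, 3 * a, c, d, f, α, 2, γ] ∈ rightCubeFamily := by
  have hβ : α + γ = 2 * 2 := by rw [hαγ]; norm_num
  have h₂ := coeff_two_of_middle h hβ
  have h₅ := coeff_five_of_middle h hf hβ
  have hd : 4 * d = a * (α * γ) := by linear_combination -h₅ / 3
  obtain rfl : γ = 4 - α := by linear_combination hαγ
  have hα : (a ^ 2 - 4 * f) * (α - 2) ^ 2 = 0 := by linear_combination (4 * h₂ + 9 * a * hd) / 9
  obtain rfl : α = 2 := sub_eq_zero.1 <| pow_eq_zero_iff two_ne_zero |>.1 <|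
    (mul_eq_zero.1 hα).resolve_left (sub_ne_zero.2 haf)
  obtain rfl : d = a := by linear_combination hd / 4
  obtain rfl := eq_of_mem_Y h
  exact ⟨d, f, by ring_nf⟩

theorem mem_mainFamily (h : ![a, b, c, d, f, α, 1, γ] ∈ Y) (hαγ : α + γ = 2)
    (hab : 2 * b = 3 * a) : ![a, b, c, d, f, α, 1, γ] ∈ mainFamily := by
  obtain rfl : γ = 2 - α := by linear_combination hαγ
  obtain rfl : b = 3 * (c - 2 * d) := by linear_combination -3 * eq_of_mem_Y h
  obtain rfl : a = 2 * (c - 2 * d) := by linear_combination -hab / 3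
  exact ⟨c, d, f, α, rfl⟩

theorem mem_midCubeFamily (h : ![a, b, c, d, f, α, 1, γ] ∈ Y) (hf : f ≠ 0) (hαγ : α + γ = 2)
    (hab : 2 * b ≠ 3 * a) (hbf : 9 * f = b * (3 * a - b)) :
    ![a, b, c, d, f, α, 1, γ] ∈ midCubeFamily := by
  have hβ : α + γ = 2 * 1 := by rw [hαγ, mul_one]
  have h₂ : (2 * b - 3 * a) * (b - 3 * d) = 0 := by
    linear_combination coeff_two_of_middle h hβ
  have h₅ : (2 * b - 3 * a) * (1 - α * γ) = 0 := by
    linear_combination coeff_five_of_middle h hf hβ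
  obtain rfl : γ = 2 - α := by linear_combination hαγ
  have hα : (α - 1) ^ 2 = 0 := by
    linear_combination (mul_eq_zero.1 h₅).resolve_left (sub_ne_zero.2 hab)
  obtain rfl : α = 1 := sub_eq_zero.1 (pow_eq_zero_iff two_ne_zero |>.1 hα)
  obtain rfl : b = 3 * d := sub_eq_zero.1 ((mul_eq_zero.1 h₂).resolve_left (sub_ne_zero.2 hab))
  obtain rfl : f = (a - d) * d := by linear_combination hbf / 9
  obtain rfl := eq_of_mem_Y h
  exact ⟨a - d, d, by ring_nf⟩

theorem mem_leftHalfFamily (h : ![a, b, c, d, f, α, 1 / 2, γ] ∈ Y) (hf : f ≠ 0)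
    (hαγ : α + γ = 1) (hbf : 9 * f = 2 * b * (3 * a - 2 * b)) :
    ![a, b, c, d, f, α, 1 / 2, γ] ∈ leftHalfFamily := by
  obtain rfl : γ = 1 - α := by linear_combination hαγ
  have hab : 3 * a - 2 * b ≠ 0 := by
    rintro hab
    exact hf (by linear_combination (hbf + 2 * b * hab) / 9)
  have h₂ : (3 * a - 2 * b) * (3 * d - b * (α * (1 - α))) = 0 := by
    linear_combination coeff_two_of_middle h (by ring) + (α * (1 - α) - 1) / 2 * hbf
  obtain rfl : d = b / 3 * (α * (1 - α)) := by
    linear_combination (mul_eq_zero.1 h₂).resolve_left hab / 3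
  obtain rfl : f = 2 * (a - 2 * (b / 3)) * (b / 3) := by linear_combination hbf / 9
  obtain rfl := eq_of_mem_Y h
  exact ⟨a - 2 * (b / 3), b / 3, α, by ring_nf⟩

theorem mem_rightHalfFamily (h : ![a, b, c, d, f, α, 3 / 2, γ] ∈ Y) (hf : f ≠ 0)
    (hαγ : α + γ = 3) (hbf : 9 * f = 2 * (3 * a - b) * (2 * b - 3 * a)) :
    ![a, b, c, d, f, α, 3 / 2, γ] ∈ rightHalfFamily := by
  obtain rfl : γ = 3 - α := by linear_combination hαγ
  have hab : 2 * b - 3 * a ≠ 0 := by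
    rintro hab
    exact hf (by linear_combination (hbf + 2 * (3 * a - b) * hab) / 9)
  have h₂ : (2 * b - 3 * a) * (3 * d - b - (3 * a - b) * (α * (3 - α) - 3)) = 0 := by
    linear_combination -coeff_two_of_middle h (by ring) + (α * (3 - α) - 3) / 2 * hbf
  obtain rfl : d = (a - b / 3) * ((α - 1) * (2 - α)) + (2 * (b / 3) - a) := by
    linear_combination (mul_eq_zero.1 h₂).resolve_left hab / 3
  obtain rfl : f = 2 * (2 * (b / 3) - a) * (a - b / 3) := by linear_combination hbf / 9
  obtain rfl := eq_of_mem_Y h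
  exact ⟨2 * (b / 3) - a, a - b / 3, α, by ring_nf⟩

theorem mem_of_double_root (hm : m ≠ 0) (h : ![-(m + m), b, c, d, m * m, α, β, γ] ∈ Y)
    (hβ : α + γ = 2 * β) :
    ![-(m + m), b, c, d, m * m, α, β, γ] ∈ transverseFamily ∪ mainFamily := by
  obtain ⟨l, -, hb⟩ := exists_residue hm h
  obtain rfl : b = -3 * m * β := by linear_combination hb - m * hβ
  have h₂ : m * ((β - 1) * (2 * d + m * (α * γ))) = 0 := by
    linear_combination coeff_two_of_middle h hβ / 9
  rcases mul_eq_zero.1 ((mul_eq_zero.1 h₂).resolve_left hm) with hβ1 | hd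
  · obtain rfl : β = 1 := sub_eq_zero.1 hβ1
    exact .inr (mem_mainFamily h (by rw [hβ, mul_one]) (by ring))
  · obtain rfl : d = -(m / 2 * (α * γ)) := by linear_combination hd / 2
    obtain rfl : β = (α + γ) / 2 := by linear_combination -hβ / 2
    obtain rfl := eq_of_mem_Y h
    exact .inl ⟨-(m + m), α, γ, by ring_nf⟩

theorem mem_of_distinct_roots (hm : m ≠ 0) (hn : n ≠ 0) (hmn : m ≠ n)
    (h : ![-(m + n), b, c, d, m * n, α, β, γ] ∈ Y) (hβ : α + γ = 2 * β) :
    ![-(m + n), b, c, d, m * n, α, β, γ] ∈ mainFamily ∪ leftHalfFamily ∪ rightHalfFamily ∪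
      leftCubeFamily ∪ midCubeFamily ∪ rightCubeFamily := by
  have hf := mul_ne_zero hm hn
  have haf : (-(m + n)) ^ 2 ≠ 4 * (m * n) := fun heq =>
    hmn (sub_eq_zero.1 (pow_eq_zero_iff two_ne_zero |>.1 (by linear_combination heq)))
  have hsum : α + β + γ = 3 * β := by linear_combination hβ
  have hm_residue := exists_residue hm h
  have hn_residue := exists_residue (m := n) (n := m) hn (by rwa [add_comm n, mul_comm n])
  rw [hsum] at hm_residue hn_residue
  rcases middle_exponent_of_distinct_roots hmn hm_residue hn_residue with
    ⟨rfl, rfl⟩ | ⟨rfl, rfl⟩ | ⟨rfl, hb⟩ | ⟨rfl, hb⟩ | ⟨rfl, hb | hb⟩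
  · exact .inl (.inl (.inr (mem_leftCubeFamily h hf (by rw [hβ, mul_zero]) haf)))
  · exact .inr (mem_rightCubeFamily h hf (by rw [hβ]; norm_num) haf)
  · exact .inl (.inl (.inl (.inl (.inr (mem_leftHalfFamily h hf (by rw [hβ]; norm_num) hb)))))
  · exact .inl (.inl (.inl (.inr (mem_rightHalfFamily h hf (by rw [hβ]; norm_num) hb))))
  · exact .inl (.inl (.inl (.inl (.inl (mem_mainFamily h (by rw [hβ, mul_one]) hb)))))
  · by_cases hab : 2 * b = 3 * -(m + n)
    · exact .inl (.inl (.inl (.inl (.inl (mem_mainFamily h (by rw [hβ, mul_one]) hab)))))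
    · exact .inl (.inr (mem_midCubeFamily h hf (by rw [hβ, mul_one]) hab hb))

theorem exists_mem_component_of_middle (h : ![a, b, c, d, f, α, β, γ] ∈ Y) (hf : f ≠ 0)
    (hβ : α + γ = 2 * β) : ∃ i, ![a, b, c, d, f, α, β, γ] ∈ component i := by
  obtain ⟨m, n, rfl, rfl⟩ : ∃ m n, a = -(m + n) ∧ f = m * n := by
    obtain ⟨z, hz⟩ := IsAlgClosed.exists_eq_mul_self (a ^ 2 - 4 * f)
    exact ⟨(z - a) / 2, (-z - a) / 2, by ring, by linear_combination -hz / 4⟩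
  have hm := left_ne_zero_of_mul hf
  rcases eq_or_ne m n with rfl | hmn
  · rcases mem_of_double_root hm h hβ with h | h
    exacts [⟨0, h⟩, ⟨1, h⟩]
  · rcases mem_of_distinct_roots hm (right_ne_zero_of_mul hf) hmn h hβ with
      ((((h | h) | h) | h) | h) | h
    exacts [⟨1, h⟩, ⟨2, h⟩, ⟨3, h⟩, ⟨4, h⟩, ⟨5, h⟩, ⟨6, h⟩]

theorem exists_mem_component_of_f_eq_zero (h : ![a, b, c, d, 0, α, β, γ] ∈ Y) :
    ∃ i, ![a, b, c, d, 0, α, β, γ] ∈ component i := by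
  rcases mem_of_f_eq_zero h with (h | h) | h
  exacts [⟨7, h⟩, ⟨8, h⟩, ⟨9, h⟩]

end Solving

/-! ### Relabelling the exponents -/

section Relabelling

variable (π ρ : Equiv.Perm (Fin 3)) (p : Fin 8 → ℂ) (Z : Set (Fin 8 → ℂ))

theorem exponents_permExponents (i : Fin 3) :
    exponents (permExponents π p) i = exponents p (π i) := by
  fin_cases i <;> rfl

theorem permExponents_permExponents :
    permExponents π (permExponents ρ p) = permExponents (ρ * π) p := by
  rw [permExponents]
  simp only [exponents_permExponents]
  rfl

theorem permExponents_one : permExponents 1 p = p :=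
  FinVec.etaExpand_eq p

theorem permExponents_image_permExponents_image :
    permExponents π '' (permExponents ρ '' Z) = permExponents (ρ * π) '' Z := by
  simp only [Set.image_image, permExponents_permExponents]

theorem permExponents_one_image : permExponents 1 '' Z = Z := by
  simp only [permExponents_one, Set.image_id']

theorem permExponents_image_eq_preimage :
    permExponents π '' Z = permExponents π⁻¹ ⁻¹' Z := by
  refine congrFun (Set.image_eq_preimage_of_inverse (fun p => ?_) fun p => ?_) Z
  · rw [permExponents_permExponents, mul_inv_cancel, permExponents_one]
  · rw [permExponents_permExponents, inv_mul_cancel, permExponents_one]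

variable {π ρ Z} in
theorem permExponents_image_eq_of_subset (h : Z ⊆ permExponents π '' Z) :
    permExponents π '' Z = Z := by
  have : Finite (Equiv.Perm (Fin 3))ᵐᵒᵖ := .of_equiv _ MulOpposite.opEquiv
  let _ : MulAction (Equiv.Perm (Fin 3))ᵐᵒᵖ (Set (Fin 8 → ℂ)) :=
    { smul π Z := permExponents π.unop '' Z
      one_smul := permExponents_one_image
      mul_smul π ρ Z := (permExponents_image_permExponents_image π.unop ρ.unop Z).symm }
  have : CovariantClass (Equiv.Perm (Fin 3))ᵐᵒᵖ (Set (Fin 8 → ℂ)) HSMul.hSMul LE.le :=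
    ⟨fun _ _ _ => Set.image_mono⟩
  exact smul_eq_of_le_smul (g := MulOpposite.op π) h

variable {π ρ Z} in
theorem permExponents_image_eq_of_subset_image
    (h : permExponents π '' Z ⊆ permExponents ρ '' Z) :
    permExponents π '' Z = permExponents ρ '' Z := by
  have hsub := Set.image_mono (f := permExponents π⁻¹) h
  rw [permExponents_image_permExponents_image, permExponents_image_permExponents_image,
    mul_inv_cancel, permExponents_one_image] at hsub
  have heq := congrArg (permExponents π '' ·) (permExponents_image_eq_of_subset hsub)
  rw [permExponents_image_permExponents_image, inv_mul_cancel_right] at heq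
  exact heq.symm

theorem permExponents_sum :
    permExponents π p 5 + permExponents π p 6 + permExponents π p 7 = p 5 + p 6 + p 7 := by
  have h := Equiv.sum_comp π (exponents p)
  rwa [Fin.sum_univ_three, Fin.sum_univ_three] at h

theorem permExponents_prod :
    permExponents π p 5 * permExponents π p 6 * permExponents π p 7 = p 5 * p 6 * p 7 := by
  have h := Equiv.prod_comp π (exponents p)
  rwa [Fin.prod_univ_three, Fin.prod_univ_three] at h

theorem permExponents_sum_mul :
    permExponents π p 5 * permExponents π p 6 + permExponents π p 5 * permExponents π p 7
      + permExponents π p 6 * permExponents π p 7 = p 5 * p 6 + p 5 * p 7 + p 6 * p 7 := by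
  have hsum := permExponents_sum π p
  have hsq : permExponents π p 5 ^ 2 + permExponents π p 6 ^ 2 + permExponents π p 7 ^ 2 =
      p 5 ^ 2 + p 6 ^ 2 + p 7 ^ 2 := by
    have h := Equiv.sum_comp π fun i => exponents p i ^ 2
    rwa [Fin.sum_univ_three, Fin.sum_univ_three] at h
  linear_combination (1 / 2) * (permExponents π p 5 + permExponents π p 6 + permExponents π p 7
    + (p 5 + p 6 + p 7)) * hsum - 1 / 2 * hsq

variable {p} in
theorem permExponents_mem_Y_iff : permExponents π p ∈ Y ↔ p ∈ Y := by
  rw [mem_Y_iff_cyCoeffs, mem_Y_iff_cyCoeffs, permExponents_sum, permExponents_prod,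
    permExponents_sum_mul]
  rfl

theorem continuous_permExponents :
    @Continuous _ _ (zariski (Fin 8)) (zariski (Fin 8)) (permExponents π) := by
  have exponents_apply (p : Fin 8 → ℂ) (i : Fin 3) : exponents p i = p (![5, 6, 7] i) := by
    fin_cases i <;> rfl
  apply continuous_zariski
  simp only [permExponents, exponents_apply]
  fun_prop

end Relabelling

theorem exists_permExponents_mem_component {p : Fin 8 → ℂ} (hp : p ∈ Y) :
    ∃ π i, permExponents π p ∈ component i := by
  obtain ⟨a, b, c, d, f, α, β, γ, rfl⟩ :
      ∃ a b c d f α β γ, p = ![a, b, c, d, f, α, β, γ] :=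
    ⟨_, _, _, _, _, _, _, _, (FinVec.etaExpand_eq p).symm⟩
  by_cases hf : f = 0
  · subst hf
    exact ⟨1, (permExponents_one _).symm ▸ exists_mem_component_of_f_eq_zero hp⟩
  rcases middle_of_f_ne_zero hp hf with hβ | hγ | hα
  · exact ⟨1, (permExponents_one _).symm ▸ exists_mem_component_of_middle hp hf hβ⟩
  · have hperm := (permExponents_mem_Y_iff (Equiv.swap 1 2)).2 hp
    exact ⟨Equiv.swap 1 2, exists_mem_component_of_middle hperm hf hγ⟩
  · have hperm := (permExponents_mem_Y_iff (Equiv.swap 0 1)).2 hp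
    exact ⟨Equiv.swap 0 1, exists_mem_component_of_middle hperm hf hα⟩

theorem Y_eq_iUnion :
    Y = ⋃ x : Fin 10 × Equiv.Perm (Fin 3), permExponents x.2 '' component x.1 := by
  ext p
  simp only [Set.mem_iUnion]
  constructor
  · intro hp
    obtain ⟨π, i, hi⟩ := exists_permExponents_mem_component hp
    refine ⟨(i, π⁻¹), permExponents π p, hi, ?_⟩
    rw [permExponents_permExponents, mul_inv_cancel, permExponents_one]
  · rintro ⟨⟨i, π⟩, q, hq, rfl⟩
    exact (permExponents_mem_Y_iff π).2 (component_subset_Y i hq)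

/-! ### The components as affine spaces -/

theorem isEmbeddedAffineSpace_transverseFamily :
    IsEmbeddedAffineSpace (Fin 3) transverseFamily := by
  refine ⟨fun t => ![t 0, t 0 / 4 * (3 * (t 1 + t 2)), t 0 / 4 * (t 1 + t 2 + 2 * t 1 * t 2),
    t 0 / 4 * (t 1 * t 2), (t 0 / 2) ^ 2, t 1, (t 1 + t 2) / 2, t 2], fun p => ![p 0, p 5, p 7],
    by fun_prop, by fun_prop, fun t => FinVec.etaExpand_eq t, Set.ext fun p => ⟨?_, ?_⟩⟩
  · rintro ⟨a, α, β, rfl⟩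
    exact ⟨![a, α, β], rfl⟩
  · rintro ⟨t, rfl⟩
    exact ⟨t 0, t 1, t 2, rfl⟩

theorem isEmbeddedAffineSpace_mainFamily : IsEmbeddedAffineSpace (Fin 4) mainFamily := by
  refine ⟨fun t => ![2 * (t 0 - 2 * t 1), 3 * (t 0 - 2 * t 1), t 0, t 1, t 2, t 3, 1, 2 - t 3],
    fun p => ![p 2, p 3, p 4, p 5], by fun_prop, by fun_prop, fun t => FinVec.etaExpand_eq t,
    Set.ext fun p => ⟨?_, ?_⟩⟩
  · rintro ⟨c, d, f, α, rfl⟩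
    exact ⟨![c, d, f, α], rfl⟩
  · rintro ⟨t, rfl⟩
    exact ⟨t 0, t 1, t 2, t 3, rfl⟩

theorem isEmbeddedAffineSpace_leftHalfFamily :
    IsEmbeddedAffineSpace (Fin 3) leftHalfFamily := by
  refine ⟨fun t => ![t 0 + 2 * t 1, 3 * t 1, t 1 + 2 * (t 1 * (t 2 * (1 - t 2))),
    t 1 * (t 2 * (1 - t 2)), 2 * t 0 * t 1, t 2, 1 / 2, 1 - t 2],
    fun p => ![p 0 - 2 / 3 * p 1, 1 / 3 * p 1, p 5], by fun_prop, by fun_prop, fun t => ?_,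
    Set.ext fun p => ⟨?_, ?_⟩⟩
  · funext i
    fin_cases i <;> simp
    ring
  · rintro ⟨m, k, α, rfl⟩
    exact ⟨![m, k, α], rfl⟩
  · rintro ⟨t, rfl⟩
    exact ⟨t 0, t 1, t 2, rfl⟩

theorem isEmbeddedAffineSpace_rightHalfFamily :
    IsEmbeddedAffineSpace (Fin 3) rightHalfFamily := by
  refine ⟨fun t => ![t 0 + 2 * t 1, 3 * t 1 + 3 * t 0,
    t 1 + 2 * (t 1 * ((t 2 - 1) * (2 - t 2))) + 3 * t 0, t 1 * ((t 2 - 1) * (2 - t 2)) + t 0,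
    2 * t 0 * t 1, t 2, 3 / 2, 3 - t 2],
    fun p => ![2 / 3 * p 1 - p 0, p 0 - 1 / 3 * p 1, p 5], by fun_prop, by fun_prop, fun t => ?_,
    Set.ext fun p => ⟨?_, ?_⟩⟩
  · funext i
    fin_cases i <;> simp <;> ring
  · rintro ⟨m, k, α, rfl⟩
    exact ⟨![m, k, α], rfl⟩
  · rintro ⟨t, rfl⟩
    exact ⟨t 0, t 1, t 2, rfl⟩

theorem isEmbeddedAffineSpace_leftCubeFamily :
    IsEmbeddedAffineSpace (Fin 2) leftCubeFamily := by
  refine ⟨fun t => ![t 0, 0, 0, 0, t 1, 0, 0, 0], fun p => ![p 0, p 4], by fun_prop, by fun_prop,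
    fun t => FinVec.etaExpand_eq t, Set.ext fun p => ⟨?_, ?_⟩⟩
  · rintro ⟨a, f, rfl⟩
    exact ⟨![a, f], rfl⟩
  · rintro ⟨t, rfl⟩
    exact ⟨t 0, t 1, rfl⟩

theorem isEmbeddedAffineSpace_midCubeFamily :
    IsEmbeddedAffineSpace (Fin 2) midCubeFamily := by
  refine ⟨fun t => ![t 0 + t 1, 3 * t 1, 3 * t 1, t 1, t 0 * t 1, 1, 1, 1],
    fun p => ![p 0 - p 3, p 3], by fun_prop, by fun_prop, fun t => ?_,
    Set.ext fun p => ⟨?_, ?_⟩⟩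
  · funext i
    fin_cases i <;> simp
  · rintro ⟨m, n, rfl⟩
    exact ⟨![m, n], rfl⟩
  · rintro ⟨t, rfl⟩
    exact ⟨t 0, t 1, rfl⟩

theorem isEmbeddedAffineSpace_rightCubeFamily :
    IsEmbeddedAffineSpace (Fin 2) rightCubeFamily := by
  refine ⟨fun t => ![t 0, 3 * t 0, 3 * t 0, t 0, t 1, 2, 2, 2], fun p => ![p 0, p 4],
    by fun_prop, by fun_prop, fun t => FinVec.etaExpand_eq t, Set.ext fun p => ⟨?_, ?_⟩⟩
  · rintro ⟨a, f, rfl⟩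
    exact ⟨![a, f], rfl⟩
  · rintro ⟨t, rfl⟩
    exact ⟨t 0, t 1, rfl⟩

theorem isEmbeddedAffineSpace_hypergeomFamily :
    IsEmbeddedAffineSpace (Fin 5) hypergeomFamily := by
  refine ⟨fun t => ![2 * t 0, 3 * t 0, t 0 + 2 * t 1, t 1, 0, t 2, t 3, t 4],
    fun p => ![p 1 - p 0, p 3, p 5, p 6, p 7], by fun_prop, by fun_prop, fun t => ?_,
    Set.ext fun p => ⟨?_, ?_⟩⟩
  · funext i
    fin_cases i <;> simp
    ring
  · rintro ⟨k, d, α, β, γ, rfl⟩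
    exact ⟨![k, d, α, β, γ], rfl⟩
  · rintro ⟨t, rfl⟩
    exact ⟨t 0, t 1, t 2, t 3, t 4, rfl⟩

theorem isEmbeddedAffineSpace_leftCubeLinearFamily :
    IsEmbeddedAffineSpace (Fin 4) leftCubeLinearFamily := by
  refine ⟨fun t => ![t 0, 0, 0, 0, 0, t 1, t 2, t 3], fun p => ![p 0, p 5, p 6, p 7],
    by fun_prop, by fun_prop, fun t => FinVec.etaExpand_eq t, Set.ext fun p => ⟨?_, ?_⟩⟩
  · rintro ⟨a, α, β, γ, rfl⟩
    exact ⟨![a, α, β, γ], rfl⟩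
  · rintro ⟨t, rfl⟩
    exact ⟨t 0, t 1, t 2, t 3, rfl⟩

theorem isEmbeddedAffineSpace_rightCubeLinearFamily :
    IsEmbeddedAffineSpace (Fin 4) rightCubeLinearFamily := by
  refine ⟨fun t => ![t 0, 3 * t 0, 3 * t 0, t 0, 0, t 1, t 2, t 3], fun p => ![p 0, p 5, p 6, p 7],
    by fun_prop, by fun_prop, fun t => FinVec.etaExpand_eq t, Set.ext fun p => ⟨?_, ?_⟩⟩
  · rintro ⟨a, α, β, γ, rfl⟩
    exact ⟨![a, α, β, γ], rfl⟩
  · rintro ⟨t, rfl⟩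
    exact ⟨t 0, t 1, t 2, t 3, rfl⟩

/-- The number of parameters of each of the ten families. -/
def componentDim : Fin 10 → ℕ := ![3, 4, 3, 3, 2, 2, 2, 5, 4, 4]

theorem isEmbeddedAffineSpace_component (i : Fin 10) :
    IsEmbeddedAffineSpace (Fin (componentDim i)) (component i) := by
  fin_cases i
  exacts [isEmbeddedAffineSpace_transverseFamily, isEmbeddedAffineSpace_mainFamily,
    isEmbeddedAffineSpace_leftHalfFamily, isEmbeddedAffineSpace_rightHalfFamily,
    isEmbeddedAffineSpace_leftCubeFamily, isEmbeddedAffineSpace_midCubeFamily,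
    isEmbeddedAffineSpace_rightCubeFamily, isEmbeddedAffineSpace_hypergeomFamily,
    isEmbeddedAffineSpace_leftCubeLinearFamily, isEmbeddedAffineSpace_rightCubeLinearFamily]

theorem algDim_component (i : Fin 10) : algDim (component i) = componentDim i := by
  rw [(isEmbeddedAffineSpace_component i).algDim_eq, Nat.card_fin]

theorem isIrreducible_permExponents_component (i : Fin 10) (π : Equiv.Perm (Fin 3)) :
    @IsIrreducible _ (zariski (Fin 8)) (permExponents π '' component i) :=
  let _ := zariski (Fin 8)
  (isEmbeddedAffineSpace_component i).isIrreducible.image _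
    (continuous_permExponents π).continuousOn

theorem isClosed_permExponents_component (i : Fin 10) (π : Equiv.Perm (Fin 3)) :
    IsClosed[zariski (Fin 8)] (permExponents π '' component i) := by
  rw [permExponents_image_eq_preimage]
  exact @IsClosed.preimage _ _ (zariski _) (zariski _) _ (continuous_permExponents π⁻¹) _
    (isEmbeddedAffineSpace_component i).isClosed

theorem isClosed_Y : IsClosed[zariski (Fin 8)] Y := by
  rw [Y_eq_iUnion]
  exact @isClosed_iUnion_of_finite _ _ (zariski _) _ _ fun x =>
    isClosed_permExponents_component x.1 x.2

/-! ### Separating the components -/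

/-- A condition that is invariant under relabelling and holds on the whole `i`-th component, but on
no whole other component: it separates the components up to relabelling. -/
def componentInvariant (i : Fin 10) (p : Fin 8 → ℂ) : Prop :=
  ![4 * p 4 = p 0 ^ 2, p 5 + p 6 + p 7 = 3 ∧ 3 * p 0 = 2 * p 1, p 5 + p 6 + p 7 = 3 / 2,
    p 5 + p 6 + p 7 = 9 / 2, p 5 + p 6 + p 7 = 0, p 5 + p 6 + p 7 = 3 ∧ p 5 * p 6 * p 7 = 1,
    p 5 + p 6 + p 7 = 6, p 4 = 0 ∧ 3 * p 0 = 2 * p 1, p 4 = 0 ∧ p 1 = 0,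
    p 4 = 0 ∧ p 1 = 3 * p 0] i

theorem componentInvariant_permExponents (i : Fin 10) (π : Equiv.Perm (Fin 3)) (p : Fin 8 → ℂ) :
    componentInvariant i (permExponents π p) ↔ componentInvariant i p := by
  rw [componentInvariant, permExponents_sum, permExponents_prod]
  rfl

theorem componentInvariant_of_mem {i : Fin 10} {p : Fin 8 → ℂ} (hp : p ∈ component i) :
    componentInvariant i p := by
  fin_cases i
  · obtain ⟨a, α, β, rfl⟩ := hp
    change 4 * (a / 2) ^ 2 = a ^ 2
    ring
  · obtain ⟨c, d, f, α, rfl⟩ := hp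
    change α + 1 + (2 - α) = 3 ∧ 3 * (2 * (c - 2 * d)) = 2 * (3 * (c - 2 * d))
    exact ⟨by ring, by ring⟩
  · obtain ⟨m, k, α, rfl⟩ := hp
    change α + 1 / 2 + (1 - α) = 3 / 2
    ring
  · obtain ⟨m, k, α, rfl⟩ := hp
    change α + 3 / 2 + (3 - α) = 9 / 2
    ring
  · obtain ⟨a, f, rfl⟩ := hp
    change (0 : ℂ) + 0 + 0 = 0
    norm_num
  · obtain ⟨m, n, rfl⟩ := hp
    change (1 : ℂ) + 1 + 1 = 3 ∧ (1 : ℂ) * 1 * 1 = 1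
    norm_num
  · obtain ⟨a, f, rfl⟩ := hp
    change (2 : ℂ) + 2 + 2 = 6
    norm_num
  · obtain ⟨k, d, α, β, γ, rfl⟩ := hp
    exact ⟨rfl, mul_left_comm 3 2 k⟩
  · obtain ⟨a, α, β, γ, rfl⟩ := hp
    exact ⟨rfl, rfl⟩
  · obtain ⟨a, α, β, γ, rfl⟩ := hp
    exact ⟨rfl, rfl⟩

/-- A point of each component that lies on no relabelling of another component. -/
def witnessPoint : Fin 10 → Fin 8 → ℂ :=
  ![![4, 18, 24, 9, 4, 3, 3, 3], ![0, 0, 2, 1, 1, 0, 1, 2], ![3, 3, 1, 0, 2, 0, 1 / 2, 1],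
    ![3, 6, 4, 1, 2, 1, 3 / 2, 2], ![0, 0, 0, 0, 1, 0, 0, 0], ![3, 3, 3, 1, 2, 1, 1, 1],
    ![0, 0, 0, 0, 1, 2, 2, 2], ![2, 3, 1, 0, 0, 3, 3, 3], ![1, 0, 0, 0, 0, 3, 3, 3],
    ![1, 3, 3, 1, 0, 3, 3, 3]]

theorem witnessPoint_mem (i : Fin 10) : witnessPoint i ∈ component i := by
  fin_cases i
  · exact ⟨4, 3, 3, by norm_num [witnessPoint]⟩
  · exact ⟨2, 1, 1, 0, by norm_num [witnessPoint]⟩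
  · exact ⟨1, 1, 0, by norm_num [witnessPoint]⟩
  · exact ⟨1, 1, 1, by norm_num [witnessPoint]⟩
  · exact ⟨0, 1, rfl⟩
  · exact ⟨2, 1, by norm_num [witnessPoint]⟩
  · exact ⟨0, 1, by norm_num [witnessPoint]⟩
  · exact ⟨1, 0, 3, 3, 3, by norm_num [witnessPoint]⟩
  · exact ⟨1, 3, 3, 3, rfl⟩
  · exact ⟨1, 3, 3, 3, by norm_num [witnessPoint]⟩

theorem eq_of_componentInvariant_witnessPoint {i j : Fin 10}
    (h : componentInvariant j (witnessPoint i)) : i = j := by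
  contrapose h
  fin_cases i <;> fin_cases j <;>
    first
    | exact absurd rfl h
    | simp only [Fin.zero_eta, Fin.mk_one, Fin.reduceFinMk, componentInvariant, witnessPoint,
        Matrix.cons_val]
      norm_num

theorem eq_of_permExponents_component_subset {i j : Fin 10} {π ρ : Equiv.Perm (Fin 3)}
    (h : permExponents π '' component i ⊆ permExponents ρ '' component j) : i = j := by
  obtain ⟨q, hq, hqi⟩ := h (Set.mem_image_of_mem _ (witnessPoint_mem i))
  apply eq_of_componentInvariant_witnessPoint
  rw [← componentInvariant_permExponents j π, ← hqi, componentInvariant_permExponents]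
  exact componentInvariant_of_mem hq

theorem irredComponents_Y : irredComponents Y =
    Set.range fun x : Fin 10 × Equiv.Perm (Fin 3) => permExponents x.2 '' component x.1 := by
  let _ := zariski (Fin 8)
  rw [irredComponents, Y_eq_iUnion]
  refine setOf_maximal_isIrreducible_iUnion
    (fun x => isIrreducible_permExponents_component x.1 x.2)
    (fun x => isClosed_permExponents_component x.1 x.2) ?_
  rintro ⟨i, π⟩ ⟨j, ρ⟩ h
  obtain rfl := eq_of_permExponents_component_subset h
  exact (permExponents_image_eq_of_subset_image h).ge

theorem sUnion_irredComponents_Y : ⋃₀ irredComponents Y = Y := by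
  rw [irredComponents_Y, Set.sUnion_range, Y_eq_iUnion]

theorem component_mem_irredComponents_Y (i : Fin 10) : component i ∈ irredComponents Y := by
  rw [irredComponents_Y]
  exact ⟨(i, 1), permExponents_one_image _⟩

theorem existsUnique_eq_permExponents_component {Z : Set (Fin 8 → ℂ)}
    (hZ : Z ∈ irredComponents Y) :
    ∃! i, ∃ π : Equiv.Perm (Fin 3), Z = permExponents π '' component i := by
  rw [irredComponents_Y] at hZ
  obtain ⟨⟨i, π⟩, rfl⟩ := hZ
  exact ⟨i, ⟨π, rfl⟩, fun j ⟨ρ, hρ⟩ => eq_of_permExponents_component_subset hρ.ge⟩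

theorem permExponents_image_mem_irredComponents_Y {Z : Set (Fin 8 → ℂ)}
    (hZ : Z ∈ irredComponents Y) (π : Equiv.Perm (Fin 3)) :
    permExponents π '' Z ∈ irredComponents Y := by
  rw [irredComponents_Y] at hZ ⊢
  obtain ⟨⟨i, ρ⟩, rfl⟩ := hZ
  exact ⟨(i, ρ * π), (permExponents_image_permExponents_image _ _ _).symm⟩

theorem exists_mem_component_f_ne_zero_iff (i : Fin 10) :
    (∃ p ∈ component i, p 4 ≠ 0) ↔ i < 7 := by
  constructor
  · rintro ⟨p, hp, hf⟩
    contrapose! hf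
    have hinv := componentInvariant_of_mem hp
    obtain rfl | rfl | rfl : i = 7 ∨ i = 8 ∨ i = 9 := by lia
    exacts [hinv.1, hinv.1, hinv.1]
  · intro hi
    refine ⟨witnessPoint i, witnessPoint_mem i, ?_⟩
    fin_cases i <;>
      first
      | exact absurd hi (by decide)
      | simp only [Fin.zero_eta, Fin.mk_one, Fin.reduceFinMk, witnessPoint, Matrix.cons_val]
        norm_num

theorem not_exists_sigma_eq_on_transverseFamily :
    ¬ ∃ s : ℂ, ∀ p ∈ transverseFamily, p 4 ≠ 0 → sigma p = s := by
  rintro ⟨s, hs⟩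
  have h₀ := hs _ ⟨2, 0, 0, rfl⟩ (by simp)
  have h₁ := hs _ ⟨2, 1, 1, rfl⟩ (by simp)
  rw [← h₁] at h₀
  simp only [sigma, Matrix.cons_val] at h₀
  norm_num at h₀

theorem sigma_eq_of_mem_mainFamily {p : Fin 8 → ℂ} (hp : p ∈ mainFamily) : sigma p = 2 := by
  rw [sigma, (componentInvariant_of_mem (i := 1) hp).1]
  norm_num

theorem sigma_eq_of_mem_leftHalfFamily {p : Fin 8 → ℂ} (hp : p ∈ leftHalfFamily) :
    sigma p = 1 := by
  have hsum : p 5 + p 6 + p 7 = 3 / 2 := componentInvariant_of_mem (i := 2) hp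
  norm_num [sigma, hsum]

theorem sigma_eq_of_mem_rightHalfFamily {p : Fin 8 → ℂ} (hp : p ∈ rightHalfFamily) :
    sigma p = 3 := by
  have hsum : p 5 + p 6 + p 7 = 9 / 2 := componentInvariant_of_mem (i := 3) hp
  norm_num [sigma, hsum]

theorem sigma_eq_of_mem_leftCubeFamily {p : Fin 8 → ℂ} (hp : p ∈ leftCubeFamily) :
    sigma p = 0 := by
  have hsum : p 5 + p 6 + p 7 = 0 := componentInvariant_of_mem (i := 4) hp
  norm_num [sigma, hsum]

theorem sigma_eq_of_mem_midCubeFamily {p : Fin 8 → ℂ} (hp : p ∈ midCubeFamily) :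
    sigma p = 2 := by
  rw [sigma, (componentInvariant_of_mem (i := 5) hp).1]
  norm_num

theorem sigma_eq_of_mem_rightCubeFamily {p : Fin 8 → ℂ} (hp : p ∈ rightCubeFamily) :
    sigma p = 4 := by
  have hsum : p 5 + p 6 + p 7 = 6 := componentInvariant_of_mem (i := 6) hp
  norm_num [sigma, hsum]

end CYThird

end

theorem mainTheorem2 :
    ∃ C : Fin 10 → Set (Fin 8 → ℂ),
      -- `Y` is an algebraic set, and the union of its irreducible components
      (∃ I : Ideal (MvPolynomial (Fin 8) ℂ), CYThird.Y = MvPolynomial.zeroLocus ℂ I) ∧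
      CYThird.Y = ⋃₀ CYThird.irredComponents CYThird.Y ∧
      -- up to relabelling `α, β, γ` the irreducible components are exactly `C 0, …, C 9`
      (∀ i, C i ∈ CYThird.irredComponents CYThird.Y) ∧
      (∀ Z ∈ CYThird.irredComponents CYThird.Y,
        ∃! i, ∃ π : Equiv.Perm (Fin 3), Z = CYThird.permExponents π '' C i) ∧
      -- relabelling permutes the irreducible components
      (∀ Z ∈ CYThird.irredComponents CYThird.Y, ∀ π : Equiv.Perm (Fin 3),
        CYThird.permExponents π '' Z ∈ CYThird.irredComponents CYThird.Y) ∧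
      -- exactly seven of the ten are not contained in `f = 0`
      (∀ i, (∃ p ∈ C i, p 4 ≠ 0) ↔ i < 7) ∧
      -- the transverse component: `σ` is not fixed
      C 0 = CYThird.transverseFamily ∧
      (¬ ∃ s : ℂ, ∀ p ∈ C 0, p 4 ≠ 0 → CYThird.sigma p = s) ∧ CYThird.algDim (C 0) = 3 ∧
      -- the main component
      C 1 = CYThird.mainFamily ∧
      -- the six components with fixed `σ`, and their dimensions
      (∀ p ∈ C 1, CYThird.sigma p = 2) ∧ CYThird.algDim (C 1) = 4 ∧
      (∀ p ∈ C 2, CYThird.sigma p = 1) ∧ CYThird.algDim (C 2) = 3 ∧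
      (∀ p ∈ C 3, CYThird.sigma p = 3) ∧ CYThird.algDim (C 3) = 3 ∧
      (∀ p ∈ C 4, CYThird.sigma p = 0) ∧ CYThird.algDim (C 4) = 2 ∧
      (∀ p ∈ C 5, CYThird.sigma p = 2) ∧ CYThird.algDim (C 5) = 2 ∧
      (∀ p ∈ C 6, CYThird.sigma p = 4) ∧ CYThird.algDim (C 6) = 2 := by
  open CYThird in
  exact ⟨component, isClosed_zariski_iff.1 isClosed_Y, sUnion_irredComponents_Y.symm,
    component_mem_irredComponents_Y, fun _ => existsUnique_eq_permExponents_component,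
    fun _ => permExponents_image_mem_irredComponents_Y, exists_mem_component_f_ne_zero_iff,
    rfl, not_exists_sigma_eq_on_transverseFamily, algDim_component 0, rfl,
    fun _ => sigma_eq_of_mem_mainFamily, algDim_component 1,
    fun _ => sigma_eq_of_mem_leftHalfFamily, algDim_component 2,
    fun _ => sigma_eq_of_mem_rightHalfFamily, algDim_component 3,
    fun _ => sigma_eq_of_mem_leftCubeFamily, algDim_component 4,
    fun _ => sigma_eq_of_mem_midCubeFamily, algDim_component 5,
    fun _ => sigma_eq_of_mem_rightCubeFamily, algDim_component 6⟩
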